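/- Let $a,b>0$ be real numbers with $ab=q/p$, where $p,q$ are relatively prime positive integers. For $k,l\in\mathbb Z$ let $T_{ak}f(t)=f(t-ak)$ and $M_{bl}f(t)=e^{2\pi i blt}f(t)$ on $L^2(\mathbb R)$, and for $s\in L^2(\mathbb R)$ let $\mathcal G(s,a,b)=\{M_{bl}T_{ak}s\}_{(k,l)\in\mathbb Z^2}$. A family $\{s_{k,l}\}$ in $L^2(\mathbb R)$ is called a Riesz basis for a subspace $\mathcal V$ if its closed linear span is $\mathcal V$ and there are constants $A>0$, $B<\infty$ such that for all $c\in\ell^2(\mathbb Z^2)$ the series $\sum_{k,l}c_{k,l}s_{k,l}$ converges in $L^2(\mathbb R)$ and $$A\|c\|_{\ell^2}^2\le\Big\|\sum_{k,l\in\mathbb Z}c_{k,l}s_{k,l}\Big\|^2\le B\|c\|_{\ell^2}^2 .$$ Let $v\in L^2(\mathbb R)$ be such that $\mathcal G(v,a,b)$ is a Riesz basis for its closed linear span $\mathcal V$, and let $$w=\sum_{k,l\in\mathbb Z}h_{k,l}M_{bl}T_{ak}v ,$$ where $h=\{h_{k,l}\}$ is a sequence of complex weights for which this series converges unconditionally in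 $L^2(\mathbb R)$ (equivalently, $h\in\ell^2(\mathbb Z^2)$). Let $\boldsymbol\Phi^h$ be the $p\times p$ matrix-valued function, defined almost everywhere on $\mathbb R^2$ and $(1/a,1/b)$-periodic, with entries $$\boldsymbol\Phi^h_{r,s}(\omega,x)=\sum_{k,l\in\mathbb Z}h_{s-r+pk,\,l}\;e^{-2\pi i ab rl}\,e^{-2\pi i(blx+ak\omega)},\qquad r,s=0,\dots,p-1,$$ the series converging in $L^2([0,1/a)\times[0,1/b))$ (if $h\in\ell^1(\mathbb Z^2)$, this is almost everywhere the pointwise sum). Then $\mathcal G(w,a,b)$ is also a Riesz basis for the same space $\mathcal V$ if and only if there exist constants $A>0$ and $B<\infty$ such that $$A\,\boldsymbol I_p\le\boldsymbol\Phi^h(\omega,x)\,\boldsymbol\Phi^h(\omega,x)^{H}\le B\,\boldsymbol I_p\qquad\text{for almost all }(\omega,x)\in\mathbb R^2,$$ where $^{H}$ denotes the conjugate transpose, $\boldsymbol I_p$ is the $p\times p$ identity matrix, and $\le$ is the order of Hermitian matrices given by positive semidefiniteness of the difference. -/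

import Mathlib

open MeasureTheory
open scoped ENNReal Matrix ComplexOrder

/-! ### Riesz bases -/

/-- The family `s` is a Riesz basis for the subspace `V` of the Hilbert space `H`: its closed linear
span is `V`, and there are constants `A > 0` and `B < ∞` such that for every `c ∈ ℓ²` the series
`∑ cᵢ sᵢ` converges and `A ‖c‖² ≤ ‖∑ cᵢ sᵢ‖² ≤ B ‖c‖²`. -/
def IsRieszBasisFor {ι H : Type*} [NormedAddCommGroup H] [InnerProductSpace ℂ H]
    (s : ι → H) (V : Submodule ℂ H) : Prop :=
  (Submodule.span ℂ (Set.range s)).topologicalClosure = V ∧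
    ∃ A B : ℝ, 0 < A ∧ ∀ c : lp (fun _ : ι => ℂ) 2,
      Summable (fun i => c i • s i) ∧
      A * ‖c‖ ^ 2 ≤ ‖∑' i, c i • s i‖ ^ 2 ∧
      ‖∑' i, c i • s i‖ ^ 2 ≤ B * ‖c‖ ^ 2

/-! ### Gabor systems in `L²(ℝ)` -/

/-- The Hilbert space `L²(ℝ)` of complex square integrable functions. -/
abbrev L2R : Type := Lp ℂ 2 (volume : Measure ℝ)

/-- Translation `T_y f (t) = f (t - y)`. -/
noncomputable def translation (y : ℝ) (f : L2R) : L2R :=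
  Lp.compMeasurePreserving (fun t : ℝ => t - y) (measurePreserving_sub_right volume y) f

theorem memLp_modulation (ξ : ℝ) (f : L2R) :
    MemLp (fun t : ℝ => Complex.exp (2 * Real.pi * Complex.I * ξ * t) * f t) 2 volume := by
  refine (Lp.memLp f).of_le ?_ (Filter.Eventually.of_forall fun t => ?_)
  · exact (Continuous.aestronglyMeasurable (by fun_prop)).mul (Lp.aestronglyMeasurable f)
  · have : (2 * Real.pi * Complex.I * ξ * t : ℂ) = ((2 * Real.pi * ξ * t : ℝ) : ℂ) * Complex.I := by
      push_cast; ring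
    rw [norm_mul, this, Complex.norm_exp_ofReal_mul_I, one_mul]

/-- Modulation `M_ξ f (t) = exp (2π i ξ t) f (t)`. -/
noncomputable def modulation (ξ : ℝ) (f : L2R) : L2R :=
  (memLp_modulation ξ f).toLp

/-- The Gabor system `𝒢(s, a, b)`: the family `M_{bl} T_{ak} s`, indexed by `(k, l) ∈ ℤ²`. -/
noncomputable def gaborSystem (s : L2R) (a b : ℝ) (kl : ℤ × ℤ) : L2R :=
  modulation (b * kl.2) (translation (a * kl.1) s)

/-! ### The `Φ`-representation of a sequence -/

/-- The term with index `(k, l)` of the series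
`∑_{k,l} h_{s-r+pk,l} exp (-2π i a b r l) exp (-2π i (b l x + a k ω))`,
as a function of `z = (ω, x)`. -/
noncomputable def phiTerm (a b : ℝ) (p : ℕ) (h : ℤ × ℤ → ℂ) (r s : Fin p) (kl : ℤ × ℤ)
    (z : ℝ × ℝ) : ℂ :=
  h (((s : ℕ) : ℤ) - ((r : ℕ) : ℤ) + p * kl.1, kl.2) *
    Complex.exp (-2 * Real.pi * Complex.I * (a * b * (r : ℕ) * kl.2)) *
    Complex.exp (-2 * Real.pi * Complex.I * (b * kl.2 * z.2 + a * kl.1 * z.1))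

/-- The period cell `[0, 1/a) × [0, 1/b)` of the variables `(ω, x)`. -/
def periodCell (a b : ℝ) : Set (ℝ × ℝ) :=
  Set.Ico 0 (1 / a) ×ˢ Set.Ico 0 (1 / b)

theorem memLp_phiTerm (a b : ℝ) (p : ℕ) (h : ℤ × ℤ → ℂ) (r s : Fin p) (kl : ℤ × ℤ) :
    MemLp (phiTerm a b p h r s kl) 2 (volume.restrict (periodCell a b)) := by
  have hfin : volume (periodCell a b) < ∞ := by
    rw [periodCell, Measure.volume_eq_prod, Measure.prod_prod, Real.volume_Ico, Real.volume_Ico]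
    exact ENNReal.mul_lt_top ENNReal.ofReal_lt_top ENNReal.ofReal_lt_top
  have : IsFiniteMeasure (volume.restrict (periodCell a b)) := ⟨by simpa using hfin⟩
  have hcont : Continuous (phiTerm a b p h r s kl) := by
    unfold phiTerm
    fun_prop
  refine MemLp.of_bound hcont.aestronglyMeasurable
    ‖h (((s : ℕ) : ℤ) - ((r : ℕ) : ℤ) + p * kl.1, kl.2)‖ (Filter.Eventually.of_forall fun z => ?_)
  have h1 : (-2 * Real.pi * Complex.I * (a * b * (r : ℕ) * kl.2) : ℂ) =
      ((-2 * Real.pi * (a * b * (r : ℕ) * kl.2) : ℝ) : ℂ) * Complex.I := by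
    push_cast; ring
  have h2 : (-2 * Real.pi * Complex.I * (b * kl.2 * z.2 + a * kl.1 * z.1) : ℂ) =
      ((-2 * Real.pi * (b * kl.2 * z.2 + a * kl.1 * z.1) : ℝ) : ℂ) * Complex.I := by
    push_cast; ring
  rw [phiTerm, norm_mul, norm_mul, h1, h2, Complex.norm_exp_ofReal_mul_I,
    Complex.norm_exp_ofReal_mul_I, mul_one, mul_one]

/-- The sum of the series with entry index `(r, s)`, as an element of `L²` of the period cell. For
`h ∈ ℓ²` it is a Fourier series that converges in `L²`; for `h ∈ ℓ¹` it also converges uniformly,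
with the same sum. -/
noncomputable def phiEntry (a b : ℝ) (p : ℕ) (h : ℤ × ℤ → ℂ) (r s : Fin p) :
    Lp ℂ 2 ((volume : Measure (ℝ × ℝ)).restrict (periodCell a b)) :=
  ∑' kl : ℤ × ℤ, (memLp_phiTerm a b p h r s kl).toLp

/-- The `Φ`-representation of the sequence `h`: the `p × p` matrix-valued function of
`z = (ω, x) ∈ ℝ²`, defined almost everywhere and `(1/a, 1/b)`-periodic, with the above entries.
For `a, b > 0` the point `(fract (a ω) / a, fract (b x) / b)` is the representative of `(ω, x)` in
the period cell. -/
noncomputable def phiRep (a b : ℝ) (p : ℕ) (h : ℤ × ℤ → ℂ) (z : ℝ × ℝ) :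
    Matrix (Fin p) (Fin p) ℂ :=
  Matrix.of fun r s => phiEntry a b p h r s (Int.fract (a * z.1) / a, Int.fract (b * z.2) / b)

/-! Since `𝒢(v, a, b)` is a Riesz basis, synthesis along it is an isomorphism of `ℓ²(ℤ²)` onto `V`.
Sorting the translation index by its residue mod `p` and taking Fourier series identifies `ℓ²(ℤ²)`
with `p`-vectors of `L²` functions on the two-dimensional torus. Because `a b p = q` is an integer,
translations by multiples of `a p` commute with modulations by multiples of `b`. The only phase that
survives depends on the residue `r`, and it is the one built into the entries of `Φ^h`. The shifts
of `w` therefore correspond exactly to monomials times the rows of `Φ^h`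
(`synthesis_modulatedRows`), and the question becomes when these products form a complete Riesz
sequence of vectors on the torus.

A finite combination of them has squared norm `∫ |ξ(x) Φ(x)|² dx`, where `ξ` is a row of
trigonometric polynomials, and its coefficients have squared norm `∫ |ξ(x)|² dx`. Pointwise matrix
bounds thus integrate to Riesz bounds (`hasRieszBounds_modulatedRows`). Conversely, testing with a
scalar polynomial times a constant row gives an integrated inequality, which localizes to almost
every point (`ae_nonneg_of_integral_trigPoly`, `ae_isBoundedMatrix_of_hasRieszBounds`). Completeness
follows from the lower bound: `Φ` is square, hence invertible almost everywhere, and nothing nonzero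
is orthogonal to the modulated rows (`span_modulatedRows_dense`). -/

/-! ### Riesz bases and finite sums -/

/-- The two-sided `ℓ²` bounds of a Riesz sequence, for finite linear combinations. -/
def HasRieszBounds {ι H : Type*} [NormedAddCommGroup H] [InnerProductSpace ℂ H]
    (s : ι → H) (A B : ℝ) : Prop :=
  ∀ (F : Finset ι) (c : ι → ℂ), A * ∑ i ∈ F, ‖c i‖ ^ 2 ≤ ‖∑ i ∈ F, c i • s i‖ ^ 2 ∧
    ‖∑ i ∈ F, c i • s i‖ ^ 2 ≤ B * ∑ i ∈ F, ‖c i‖ ^ 2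

theorem lp_two_hasSum_norm_sq {ι : Type*} (c : lp (fun _ : ι => ℂ) 2) :
    HasSum (fun i => ‖c i‖ ^ 2) (‖c‖ ^ 2) := by
  simpa using lp.hasSum_norm (p := 2) (by norm_num) c

section Abstract

variable {ι H K : Type*} [NormedAddCommGroup H] [InnerProductSpace ℂ H]
  [NormedAddCommGroup K] [InnerProductSpace ℂ K]

theorem IsRieszBasisFor.hasRieszBounds {s : ι → H} {V : Submodule ℂ H}
    (hs : IsRieszBasisFor s V) : ∃ A B : ℝ, 0 < A ∧ HasRieszBounds s A B := by
  classical
  obtain ⟨-, A, B, hA, hc⟩ := hs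
  refine ⟨A, B, hA, fun F c => ?_⟩
  let d : lp (fun _ : ι => ℂ) 2 := ∑ i ∈ F, lp.single 2 i (c i)
  have hd (i : ι) : d i = if i ∈ F then c i else 0 := by
    simp only [d, lp.coeFn_sum, Finset.sum_apply, lp.single_apply, Pi.single_apply]
    simp
  have h1 : ‖d‖ ^ 2 = ∑ i ∈ F, ‖c i‖ ^ 2 := by
    rw [← (lp_two_hasSum_norm_sq d).tsum_eq, tsum_eq_sum (s := F)]
    · exact Finset.sum_congr rfl fun i hi => by rw [hd, if_pos hi]
    · intro i hi
      simp [hd, hi]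
  have h2 : ∑' i, d i • s i = ∑ i ∈ F, c i • s i := by
    rw [tsum_eq_sum (s := F)]
    · exact Finset.sum_congr rfl fun i hi => by rw [hd, if_pos hi]
    · intro i hi
      simp [hd, hi]
  have := (hc d).2
  rwa [h1, h2] at this

theorem HasRieszBounds.summable [CompleteSpace H] {s : ι → H} {A B : ℝ}
    (hs : HasRieszBounds s A B) {c : ι → ℂ} (hc : Summable fun i => ‖c i‖ ^ 2) :
    Summable fun i => c i • s i := by
  rw [summable_iff_vanishing_norm] at hc ⊢
  intro ε hε
  -- `B` carries no sign condition; `|B| + 1` is a positive majorant.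
  obtain ⟨F, hF⟩ := hc (ε ^ 2 / (|B| + 1)) (by positivity)
  refine ⟨F, fun t ht => ?_⟩
  have h1 := hF t ht
  have h2 := (hs t c).2
  have h0 : 0 ≤ ∑ i ∈ t, ‖c i‖ ^ 2 := Finset.sum_nonneg fun i _ => by positivity
  rw [Real.norm_of_nonneg h0, lt_div_iff₀ (by positivity)] at h1
  refine lt_of_pow_lt_pow_left₀ 2 hε.le ?_
  nlinarith [le_abs_self B, abs_nonneg B]

theorem HasRieszBounds.norm_sq_le [CompleteSpace H] {s : ι → H} {A B : ℝ}
    (hs : HasRieszBounds s A B) {c : ι → ℂ} {S : ℝ} (hc : HasSum (fun i => ‖c i‖ ^ 2) S) :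
    A * S ≤ ‖∑' i, c i • s i‖ ^ 2 ∧ ‖∑' i, c i • s i‖ ^ 2 ≤ B * S := by
  have h1 := ((hs.summable hc.summable).hasSum.norm.pow 2)
  exact ⟨le_of_tendsto_of_tendsto' (Filter.Tendsto.const_mul A hc) h1 fun F => (hs F c).1,
    le_of_tendsto_of_tendsto' h1 (Filter.Tendsto.const_mul B hc) fun F => (hs F c).2⟩

/-- Both inequalities pass to limits of partial sums, so finite sums suffice. All later norm
computations then involve trigonometric polynomials only. -/
theorem isRieszBasisFor_iff [CompleteSpace H] {s : ι → H} {V : Submodule ℂ H} :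
    IsRieszBasisFor s V ↔ (Submodule.span ℂ (Set.range s)).topologicalClosure = V ∧
      ∃ A B : ℝ, 0 < A ∧ HasRieszBounds s A B := by
  refine ⟨fun h => ⟨h.1, h.hasRieszBounds⟩, fun ⟨h, A, B, hA, hs⟩ => ⟨h, A, B, hA, fun c => ?_⟩⟩
  have hc := lp_two_hasSum_norm_sq c
  exact ⟨hs.summable hc.summable, hs.norm_sq_le hc⟩

theorem HasRieszBounds.comp_equiv {κ : Type*} {s : ι → H} {A B : ℝ}
    (hs : HasRieszBounds s A B) (e : κ ≃ ι) : HasRieszBounds (s ∘ e) A B := by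
  intro F c
  have := hs (F.map e.toEmbedding) (c ∘ e.symm)
  simpa using this

theorem isRieszBasisFor_comp_equiv [CompleteSpace H] {κ : Type*} {s : ι → H}
    {V : Submodule ℂ H} (e : κ ≃ ι) : IsRieszBasisFor (s ∘ e) V ↔ IsRieszBasisFor s V := by
  rw [isRieszBasisFor_iff, isRieszBasisFor_iff, e.surjective.range_comp]
  refine and_congr_right fun _ => ⟨fun ⟨A, B, hA, h⟩ => ⟨A, B, hA, ?_⟩,
    fun ⟨A, B, hA, h⟩ => ⟨A, B, hA, h.comp_equiv e⟩⟩
  have := h.comp_equiv e.symm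
  rwa [Function.comp_assoc, e.self_comp_symm, Function.comp_id] at this

/-- The coefficients of a convergent series along a Riesz sequence are square summable. -/
theorem HasRieszBounds.summable_of_hasSum {s : ι → H} {A B : ℝ} (hA : 0 < A)
    (hs : HasRieszBounds s A B) {c : ι → ℂ} {w : H} (hw : HasSum (fun i => c i • s i) w) :
    Summable fun i => ‖c i‖ ^ 2 := by
  classical
  have h1 : ∀ᶠ F : Finset ι in Filter.atTop, ‖∑ i ∈ F, c i • s i‖ < ‖w‖ + 1 :=
    hw.norm.eventually (gt_mem_nhds (lt_add_one _))
  obtain ⟨F₀, hF₀⟩ := Filter.eventually_atTop.1 h1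
  refine summable_of_sum_le (c := (‖w‖ + 1) ^ 2 / A) (fun i => by positivity) fun F => ?_
  -- Only partial sums beyond `F₀` are known to be bounded, so `F` is enlarged before the lower
  -- Riesz bound is applied.
  have h2 := hF₀ (F ∪ F₀) Finset.subset_union_right
  have h3 := (hs (F ∪ F₀) c).1
  have h4 : ∑ i ∈ F, ‖c i‖ ^ 2 ≤ ∑ i ∈ F ∪ F₀, ‖c i‖ ^ 2 :=
    Finset.sum_le_sum_of_subset_of_nonneg Finset.subset_union_left fun _ _ _ => by positivity
  rw [le_div_iff₀ hA]
  have h5 : ‖∑ i ∈ F ∪ F₀, c i • s i‖ ^ 2 ≤ (‖w‖ + 1) ^ 2 := by gcongr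
  nlinarith

/-- The synthesis operator of a Riesz basis, as an operator on a Hilbert space with a Hilbert
basis indexed by the same set. -/
theorem IsRieszBasisFor.exists_synthesis [CompleteSpace H] {f : ι → H} {V : Submodule ℂ H}
    (hf : IsRieszBasisFor f V) (b : HilbertBasis ι ℂ K) :
    ∃ R : K →L[ℂ] H, (∀ x, HasSum (fun i => b.repr x i • f i) (R x)) ∧
      (∃ A B : ℝ, 0 < A ∧ ∀ x, A * ‖x‖ ^ 2 ≤ ‖R x‖ ^ 2 ∧ ‖R x‖ ^ 2 ≤ B * ‖x‖ ^ 2) ∧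
      ∀ y, y ∈ V ↔ ∃ x, R x = y := by
  classical
  obtain ⟨hV, A, B, hA, hAB⟩ := hf
  have hsum (x : K) := (hAB (b.repr x)).1
  let R₀ : K →ₗ[ℂ] H :=
    { toFun x := ∑' i, b.repr x i • f i
      map_add' x y := by
        rw [← (hsum x).tsum_add (hsum y)]
        simp [add_smul]
      map_smul' c x := by
        rw [RingHom.id_apply, ← (hsum x).tsum_const_smul c]
        simp [mul_smul] }
  have hR₀ (x : K) : A * ‖x‖ ^ 2 ≤ ‖R₀ x‖ ^ 2 ∧ ‖R₀ x‖ ^ 2 ≤ B * ‖x‖ ^ 2 := by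
    have := (hAB (b.repr x)).2
    rwa [LinearIsometryEquiv.norm_map] at this
  let R : K →L[ℂ] H := R₀.mkContinuous (√|B|) fun x => by
    refine le_of_sq_le_sq ?_ (by positivity)
    rw [mul_pow, Real.sq_sqrt (abs_nonneg B)]
    exact (hR₀ x).2.trans (by gcongr; exact le_abs_self B)
  have hanti : AntilipschitzWith (Real.toNNReal (√A)⁻¹) R := by
    refine ContinuousLinearMap.antilipschitz_of_bound R fun x => ?_
    rw [Real.coe_toNNReal _ (by positivity), ← div_eq_inv_mul, le_div_iff₀ (by positivity)]
    refine le_of_sq_le_sq ?_ (by positivity)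
    rw [mul_pow, Real.sq_sqrt hA.le, mul_comm]
    exact (hR₀ x).1
  have hb (i : ι) : R (b i) = f i := by
    change ∑' j, b.repr (b i) j • f j = f i
    rw [tsum_eq_single i fun j hj => ?_]
    · simp [b.repr_self]
    · simp [b.repr_self, hj]
  refine ⟨R, fun x => (hsum x).hasSum, ⟨A, B, hA, hR₀⟩, fun y => ⟨fun hy => ?_, ?_⟩⟩
  -- `K` is complete, being isometric to `ℓ²`. As `R` is bounded below, its range is closed, and a
  -- closed subspace containing every `f i` contains `V`.
  · have : CompleteSpace K := b.repr.toIsometryEquiv.completeSpace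
    have hcl : IsClosed (Set.range R) := hanti.isClosed_range R.uniformContinuous
    have hle : (Submodule.span ℂ (Set.range f)).topologicalClosure ≤ LinearMap.range R.toLinearMap := by
      refine Submodule.topologicalClosure_minimal _ (Submodule.span_le.2 ?_)
        (by rw [LinearMap.coe_range]; exact hcl)
      rintro _ ⟨i, rfl⟩
      exact ⟨b i, hb i⟩
    exact hle (hV ▸ hy)
  · rintro ⟨x, rfl⟩
    rw [← hV]
    refine mem_closure_of_tendsto (hsum x).hasSum (Filter.Eventually.of_forall fun F => ?_)
    exact Submodule.sum_mem _ fun i _ => Submodule.smul_mem _ _ (Submodule.subset_span ⟨i, rfl⟩)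

/-! ### Transport of Riesz bounds along an operator bounded above and below -/

section Transport

variable {R : K →L[ℂ] H} {A B : ℝ}

theorem HasRieszBounds.map {x : ι → K} {A' B' : ℝ} (hx : HasRieszBounds x A' B') (hA : 0 ≤ A)
    (hR : ∀ x, A * ‖x‖ ^ 2 ≤ ‖R x‖ ^ 2 ∧ ‖R x‖ ^ 2 ≤ B * ‖x‖ ^ 2) :
    HasRieszBounds (R ∘ x) (A * A') (|B| * B') := by
  intro F c
  have h1 : ∑ i ∈ F, c i • (R ∘ x) i = R (∑ i ∈ F, c i • x i) := by simp
  rw [h1, mul_assoc, mul_assoc]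
  have h2 := hx F c
  refine ⟨(mul_le_mul_of_nonneg_left h2.1 hA).trans (hR _).1, (hR _).2.trans ?_⟩
  exact mul_le_mul (le_abs_self B) h2.2 (by positivity) (abs_nonneg B)

theorem HasRieszBounds.of_map {x : ι → K} {A' B' : ℝ} (hx : HasRieszBounds (R ∘ x) A' B')
    (hA : 0 < A)
    (hR : ∀ x, A * ‖x‖ ^ 2 ≤ ‖R x‖ ^ 2 ∧ ‖R x‖ ^ 2 ≤ B * ‖x‖ ^ 2) :
    HasRieszBounds x (A' / (|B| + 1)) (B' / A) := by
  intro F c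
  have h1 : ∑ i ∈ F, c i • (R ∘ x) i = R (∑ i ∈ F, c i • x i) := by simp
  have h2 := hx F c
  rw [h1] at h2
  have h3 := hR (∑ i ∈ F, c i • x i)
  rw [div_mul_eq_mul_div, div_mul_eq_mul_div, div_le_iff₀ (by positivity), le_div_iff₀ hA]
  refine ⟨h2.1.trans (h3.2.trans ?_), ?_⟩
  · nlinarith [le_abs_self B, sq_nonneg ‖∑ i ∈ F, c i • x i‖]
  · linarith [h2.2, h3.1]

/-- A bounded operator that is bounded below maps complete Riesz sequences to Riesz bases of its
range. -/
theorem isRieszBasisFor_map [CompleteSpace H] [CompleteSpace K] {x : ι → K} {V : Submodule ℂ H}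
    {A' B' : ℝ} (hA : 0 < A) (hA' : 0 < A')
    (hR : ∀ x, A * ‖x‖ ^ 2 ≤ ‖R x‖ ^ 2 ∧ ‖R x‖ ^ 2 ≤ B * ‖x‖ ^ 2)
    (hV : ∀ y, y ∈ V ↔ ∃ x, R x = y)
    (hspan : (Submodule.span ℂ (Set.range x)).topologicalClosure = ⊤)
    (hx : HasRieszBounds x A' B') : IsRieszBasisFor (R ∘ x) V := by
  refine isRieszBasisFor_iff.2 ⟨?_, _, _, mul_pos hA hA', hx.map hA.le hR⟩
  have hanti : AntilipschitzWith (Real.toNNReal (√A)⁻¹) R := by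
    refine ContinuousLinearMap.antilipschitz_of_bound R fun x => ?_
    rw [Real.coe_toNNReal _ (by positivity), ← div_eq_inv_mul, le_div_iff₀ (by positivity)]
    refine le_of_sq_le_sq ?_ (by positivity)
    rw [mul_pow, Real.sq_sqrt hA.le, mul_comm]
    exact (hR x).1
  -- A closed embedding commutes with closures, so density of the span in `K` becomes density in the
  -- range of `R`.
  have hemb := hanti.isClosedEmbedding R.uniformContinuous
  apply SetLike.coe_injective
  rw [Submodule.topologicalClosure_coe, Set.range_comp, ← ContinuousLinearMap.coe_coe R,
    ← Submodule.map_span, Submodule.map_coe, ContinuousLinearMap.coe_coe, hemb.closure_image_eq,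
    ← Submodule.topologicalClosure_coe, hspan]
  ext y
  simp [hV]

end Transport

end Abstract

/-! ### Multiplication by monomials on the torus -/

/-- The measure on `ℝ / ℤ` is the Haar measure of total mass `1`. -/
noncomputable local instance unitAddCircleHaarSpace : MeasureSpace UnitAddCircle :=
  ⟨AddCircle.haarAddCircle⟩

local instance : IsProbabilityMeasure (volume : Measure UnitAddCircle) :=
  inferInstanceAs (IsProbabilityMeasure AddCircle.haarAddCircle)

open UnitAddTorus

section Torus

variable {d : Type*} [Fintype d]

theorem norm_mFourier_apply (n : d → ℤ) (x : UnitAddTorus d) : ‖mFourier n x‖ = 1 := by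
  simp only [mFourier, ContinuousMap.coe_mk, norm_prod, fourier_apply, Circle.norm_coe,
    Finset.prod_const_one]

theorem memLp_mFourier_mul (n : d → ℤ) (f : Lp ℂ 2 (volume : Measure (UnitAddTorus d))) :
    MemLp (fun x => mFourier n x * f x) 2 volume := by
  refine (Lp.memLp f).of_le ?_ (Filter.Eventually.of_forall fun x => ?_)
  · exact (mFourier n).continuous.aestronglyMeasurable.mul (Lp.aestronglyMeasurable f)
  · rw [norm_mul, norm_mFourier_apply, one_mul]

/-- Multiplication by the monomial `mFourier n`. -/
noncomputable def mFourierMul (n : d → ℤ) (f : Lp ℂ 2 (volume : Measure (UnitAddTorus d))) :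
    Lp ℂ 2 (volume : Measure (UnitAddTorus d)) :=
  (memLp_mFourier_mul n f).toLp

theorem coeFn_mFourierMul (n : d → ℤ) (f : Lp ℂ 2 (volume : Measure (UnitAddTorus d))) :
    mFourierMul n f =ᵐ[volume] fun x => mFourier n x * f x :=
  MemLp.coeFn_toLp _

theorem mFourierCoeff_mFourierMul (n k : d → ℤ)
    (f : Lp ℂ 2 (volume : Measure (UnitAddTorus d))) :
    mFourierCoeff (mFourierMul n f) k = mFourierCoeff f (k - n) := by
  refine integral_congr_ae ?_
  filter_upwards [coeFn_mFourierMul n f] with x hx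
  rw [hx, neg_sub, sub_eq_neg_add, mFourier_add, smul_eq_mul, smul_eq_mul, mul_assoc]

variable (d) in
/-- Vectors of square integrable functions on the torus. -/
abbrev TorusVec (m : Type*) : Type _ :=
  PiLp 2 fun _ : m => Lp ℂ 2 (volume : Measure (UnitAddTorus d))

variable {m : Type*} [Fintype m]

theorem norm_sq_Lp_two {α : Type*} [MeasurableSpace α] {μ : Measure α} (f : Lp ℂ 2 μ) :
    ‖f‖ ^ 2 = ∫ x, ‖f x‖ ^ 2 ∂μ := by
  rw [← inner_self_eq_norm_sq (𝕜 := ℂ), L2.inner_def, ← integral_re (L2.integrable_inner f f)]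
  simp only [inner_self_eq_norm_sq]

/-- The norm of a finite linear combination of vectors of functions, computed pointwise. -/
theorem norm_sq_sum_torusVec {ι : Type*} {Y : ι → TorusVec d m} {y : ι → m → UnitAddTorus d → ℂ}
    (hY : ∀ j s, Y j s =ᵐ[volume] y j s) (F : Finset ι) (c : ι → ℂ) :
    Integrable (fun x => ∑ s, ‖∑ j ∈ F, c j * y j s x‖ ^ 2) volume ∧
      ‖∑ j ∈ F, c j • Y j‖ ^ 2 = ∫ x, ∑ s, ‖∑ j ∈ F, c j * y j s x‖ ^ 2 := by
  have h (s : m) : (∑ j ∈ F, c j • Y j) s =ᵐ[volume] fun x => ∑ j ∈ F, c j * y j s x := by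
    have h1 : (∑ j ∈ F, c j • Y j) s = ∑ j ∈ F, c j • Y j s := by simp
    rw [h1]
    have h2 : ∀ᵐ x, ∀ j ∈ F, (c j • Y j s : Lp ℂ 2 _) x = c j * y j s x := by
      rw [Filter.eventually_all_finset]
      intro j _
      filter_upwards [Lp.coeFn_smul (c j) (Y j s), hY j s] with x hx hx'
      rw [hx, Pi.smul_apply, hx', smul_eq_mul]
    filter_upwards [Lp.coeFn_finsetSum F fun j => (c j • Y j s : Lp ℂ 2 _), h2] with x hx hx'
    rw [hx, Finset.sum_apply]
    exact Finset.sum_congr rfl hx'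
  have hint (s : m) : Integrable (fun x => ‖∑ j ∈ F, c j * y j s x‖ ^ 2) volume := by
    have := (memLp_two_iff_integrable_sq_norm (Lp.aestronglyMeasurable _)).1
      (Lp.memLp ((∑ j ∈ F, c j • Y j) s))
    refine this.congr ?_
    filter_upwards [h s] with x hx
    rw [hx]
  refine ⟨integrable_finsetSum _ fun s _ => hint s, ?_⟩
  rw [integral_finsetSum _ fun s _ => hint s, PiLp.norm_sq_eq_of_L2]
  refine Finset.sum_congr rfl fun s _ => ?_
  rw [norm_sq_Lp_two]
  refine integral_congr_ae ?_
  filter_upwards [h s] with x hx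
  rw [hx]

variable [DecidableEq m]

theorem inner_single_torusVec (r : m) (n : d → ℤ) (x : TorusVec d m) :
    inner ℂ (PiLp.single 2 r (mFourierLp 2 n) : TorusVec d m) x = mFourierCoeff (x r) n := by
  rw [PiLp.inner_apply, Finset.sum_eq_single r]
  · rw [PiLp.single_apply, if_pos rfl, ← mFourierBasis_repr,
      HilbertBasis.repr_apply_apply, coe_mFourierBasis]
  · intro s _ hs
    rw [PiLp.single_apply, if_neg hs, inner_zero_left]
  · simp

theorem mFourierCoeff_injective {f g : Lp ℂ 2 (volume : Measure (UnitAddTorus d))}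
    (h : ∀ n, mFourierCoeff f n = mFourierCoeff g n) : f = g := by
  apply mFourierBasis.repr.injective
  ext n
  simp [mFourierBasis_repr, h]

theorem orthonormal_single_mFourierLp :
    Orthonormal ℂ fun j : m × (d → ℤ) =>
      (PiLp.single 2 j.1 (mFourierLp 2 j.2) : TorusVec d m) := by
  classical
  rw [orthonormal_iff_ite]
  rintro ⟨r, n⟩ ⟨s, k⟩
  rw [inner_single_torusVec, PiLp.single_apply]
  by_cases hrs : r = s
  · subst hrs
    rw [if_pos rfl, ← mFourierBasis_repr, HilbertBasis.repr_apply_apply, coe_mFourierBasis,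
      orthonormal_iff_ite.1 orthonormal_mFourier]
    simp
  · rw [if_neg hrs, ← mFourierBasis_repr, map_zero]
    simp [hrs]

variable (d m) in
/-- The Hilbert basis of vectors with one nonzero entry, a monomial. -/
noncomputable def torusVecBasis : HilbertBasis (m × (d → ℤ)) ℂ (TorusVec d m) :=
  HilbertBasis.mkOfOrthogonalEqBot orthonormal_single_mFourierLp (by
    rw [Submodule.eq_bot_iff]
    intro x hx
    rw [Submodule.mem_orthogonal] at hx
    ext1 r
    refine mFourierCoeff_injective fun n => ?_
    rw [← inner_single_torusVec, hx _ (Submodule.subset_span ⟨(r, n), rfl⟩), PiLp.zero_apply,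
      ← mFourierBasis_repr, map_zero]
    rfl)

theorem torusVecBasis_apply (j : m × (d → ℤ)) :
    torusVecBasis d m j = PiLp.single 2 j.1 (mFourierLp 2 j.2) := by
  rw [torusVecBasis, HilbertBasis.coe_mkOfOrthogonalEqBot]

theorem torusVecBasis_repr (x : TorusVec d m) (j : m × (d → ℤ)) :
    (torusVecBasis d m).repr x j = mFourierCoeff (x j.1) j.2 := by
  rw [HilbertBasis.repr_apply_apply, torusVecBasis_apply, inner_single_torusVec]

/-- The system `mFourier n • Φ r`, for rows `r` of the matrix `Φ` and frequencies `n`. -/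
noncomputable def modulatedRows (Φ : m → m → Lp ℂ 2 (volume : Measure (UnitAddTorus d)))
    (j : m × (d → ℤ)) : TorusVec d m :=
  WithLp.toLp 2 fun s => mFourierMul j.2 (Φ j.1 s)

/-- The vector of trigonometric polynomials with coefficients `c j`, `j ∈ F`. -/
noncomputable def trigVec (F : Finset (m × (d → ℤ))) (c : m × (d → ℤ) → ℂ) (x : UnitAddTorus d)
    (r : m) : ℂ :=
  ∑ j ∈ F, c j * (if j.1 = r then mFourier j.2 x else 0)

/-- Parseval's identity for `torusVecBasis`, with the left side computed by orthonormality and the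
right side pointwise. -/
theorem sum_norm_sq_eq_integral_trigVec (F : Finset (m × (d → ℤ))) (c : m × (d → ℤ) → ℂ) :
    Integrable (fun x => ∑ r, ‖trigVec F c x r‖ ^ 2) volume ∧
      ∑ j ∈ F, ‖c j‖ ^ 2 = ∫ x, ∑ r, ‖trigVec F c x r‖ ^ 2 := by
  have h (j : m × (d → ℤ)) (s : m) : (torusVecBasis d m j) s =ᵐ[volume]
      fun x => if j.1 = s then mFourier j.2 x else 0 := by
    rw [torusVecBasis_apply, PiLp.single_apply]
    by_cases hjs : s = j.1
    · subst hjs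
      simpa using coeFn_mFourierLp 2 j.2
    · rw [if_neg hjs]
      filter_upwards [Lp.coeFn_zero ℂ 2 (volume : Measure (UnitAddTorus d))] with x hx
      rw [hx, if_neg (Ne.symm hjs), Pi.zero_apply]
  obtain ⟨h1, h2⟩ := norm_sq_sum_torusVec h F c
  refine ⟨h1, ?_⟩
  change _ = ∫ x, ∑ s, ‖∑ j ∈ F, c j * if j.1 = s then mFourier j.2 x else 0‖ ^ 2
  rw [← h2]
  have h3 := inner_self_eq_norm_sq_to_K (𝕜 := ℂ) (∑ j ∈ F, c j • torusVecBasis d m j)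
  rw [(torusVecBasis d m).orthonormal.inner_sum] at h3
  apply Complex.ofReal_injective
  rw [Complex.ofReal_pow]
  refine Eq.trans ?_ h3
  simp [Complex.conj_mul']

/-- Summing `c j` times monomial times row collects, at each point, into one row vector of
trigonometric polynomials multiplied by the matrix. -/
theorem norm_sq_sum_modulatedRows (Φ : m → m → Lp ℂ 2 (volume : Measure (UnitAddTorus d)))
    (F : Finset (m × (d → ℤ))) (c : m × (d → ℤ) → ℂ) :
    Integrable (fun x => ∑ s, ‖(trigVec F c x ᵥ* Matrix.of fun r s => Φ r s x) s‖ ^ 2) volume ∧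
      ‖∑ j ∈ F, c j • modulatedRows Φ j‖ ^ 2 =
        ∫ x, ∑ s, ‖(trigVec F c x ᵥ* Matrix.of fun r s => Φ r s x) s‖ ^ 2 := by
  have h (j : m × (d → ℤ)) (s : m) : (modulatedRows Φ j) s =ᵐ[volume]
      fun x => mFourier j.2 x * Φ j.1 s x := coeFn_mFourierMul _ _
  have h1 (x : UnitAddTorus d) (s : m) : (trigVec F c x ᵥ* Matrix.of fun r s => Φ r s x) s =
      ∑ j ∈ F, c j * (mFourier j.2 x * Φ j.1 s x) := by
    simp only [Matrix.vecMul, dotProduct, trigVec, Matrix.of_apply, Finset.sum_mul]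
    rw [Finset.sum_comm]
    refine Finset.sum_congr rfl fun j _ => ?_
    simp [mul_assoc]
  simp only [h1]
  exact norm_sq_sum_torusVec h F c

/-- The inequalities `A I ≤ M Mᴴ ≤ B I`, expressed by row vectors. -/
def IsBoundedMatrix (A B : ℝ) (M : Matrix m m ℂ) : Prop :=
  ∀ ξ : m → ℂ, A * ∑ r, ‖ξ r‖ ^ 2 ≤ ∑ s, ‖(ξ ᵥ* M) s‖ ^ 2 ∧
    ∑ s, ‖(ξ ᵥ* M) s‖ ^ 2 ≤ B * ∑ r, ‖ξ r‖ ^ 2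

/-- The matrix inequality is applied at each `x` to the row `trigVec F c x` and then integrated. -/
theorem hasRieszBounds_modulatedRows {Φ : m → m → Lp ℂ 2 (volume : Measure (UnitAddTorus d))}
    {A B : ℝ} (h : ∀ᵐ x, IsBoundedMatrix A B (Matrix.of fun r s => Φ r s x)) :
    HasRieszBounds (modulatedRows Φ) A B := by
  intro F c
  obtain ⟨h1, h2⟩ := norm_sq_sum_modulatedRows Φ F c
  obtain ⟨h3, h4⟩ := sum_norm_sq_eq_integral_trigVec F c
  rw [h2, h4, ← integral_const_mul, ← integral_const_mul]
  constructor
  · refine integral_mono_ae (h3.const_mul A) h1 ?_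
    filter_upwards [h] with x hx using (hx _).1
  · refine integral_mono_ae h1 (h3.const_mul B) ?_
    filter_upwards [h] with x hx using (hx _).2

end Torus

/-! ### From Riesz bounds to pointwise matrix bounds, and completeness of the modulated rows -/

section TorusBounds

variable {d : Type*} [Fintype d]

/-- Trigonometric polynomials are uniformly dense in the continuous functions, which are dense in
`L²(ν)`. An arbitrary finite `ν` is allowed because a weighted measure is needed below. -/
theorem span_mFourier_toLp_dense (ν : Measure (UnitAddTorus d)) [IsFiniteMeasure ν] :
    (Submodule.span ℂ (Set.range fun n : d → ℤ =>
      ContinuousMap.toLp (E := ℂ) 2 ν ℂ (mFourier n))).topologicalClosure = ⊤ := by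
  simpa only [Submodule.map_span, ContinuousLinearMap.coe_coe, ← Set.range_comp,
    Function.comp_def] using
    (ContinuousMap.toLp_denseRange ℂ ν ℂ (by norm_num)).topologicalClosure_map_submodule
      span_mFourier_closure_eq_top

/-- An integrable function whose integral against the squared modulus of every trigonometric
polynomial is nonnegative, is nonnegative almost everywhere. -/
theorem ae_nonneg_of_integral_trigPoly {G : UnitAddTorus d → ℝ} (hG : Integrable G volume)
    (h : ∀ (F : Finset (d → ℤ)) (c : (d → ℤ) → ℂ),
      0 ≤ ∫ x, ‖∑ n ∈ F, c n * mFourier n x‖ ^ 2 * G x) : ∀ᵐ x, 0 ≤ G x := by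
  wlog hm : Measurable G generalizing G
  · have hae := hG.aestronglyMeasurable.ae_eq_mk
    have := this (hG.congr hae) (fun F c => ?_)
      hG.aestronglyMeasurable.stronglyMeasurable_mk.measurable
    · filter_upwards [this, hae] with x hx hx'
      rwa [hx']
    · rw [integral_congr_ae (g := fun x => ‖∑ n ∈ F, c n * mFourier n x‖ ^ 2 * G x)]
      · exact h F c
      · filter_upwards [hae] with x hx
        rw [hx]
  -- `G` may be unbounded, so approximation takes place in `L²(ν)` with `ν = |G| dx`. With `E = {G <
  -- 0}`, `∫ |f|² G = ‖f‖² - 2 ‖1_E f‖²` in `L²(ν)`; the hypothesis is thus a closed condition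
  -- satisfied on a dense subspace.
  let ν : Measure (UnitAddTorus d) := volume.withDensity fun x => (‖G x‖₊ : ℝ≥0∞)
  have hν : IsFiniteMeasure ν := isFiniteMeasure_withDensity hG.hasFiniteIntegral.ne
  let E : Set (UnitAddTorus d) := {x | G x < 0}
  have hE : MeasurableSet E := measurableSet_lt hm measurable_const
  let P := LpToLpRestrictCLM (UnitAddTorus d) ℂ ℂ ν 2 E
  have hP (f : Lp ℂ 2 ν) : ‖P f‖ ^ 2 = ∫ x in E, ‖f x‖ ^ 2 ∂ν := by
    rw [norm_sq_Lp_two]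
    refine integral_congr_ae ?_
    filter_upwards [LpToLpRestrictCLM_coeFn ℂ E f] with x hx
    rw [hx]
  have hcl : IsClosed {f : Lp ℂ 2 ν | 2 * ‖P f‖ ^ 2 ≤ ‖f‖ ^ 2} :=
    isClosed_le (by fun_prop) (by fun_prop)
  have hspan (f : Lp ℂ 2 ν) (hf : f ∈ Submodule.span ℂ (Set.range fun n : d → ℤ =>
      ContinuousMap.toLp (E := ℂ) 2 ν ℂ (mFourier n))) : 2 * ‖P f‖ ^ 2 ≤ ‖f‖ ^ 2 := by
    obtain ⟨c, rfl⟩ := Finsupp.mem_span_range_iff_exists_finsupp.1 hf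
    let g : C(UnitAddTorus d, ℂ) := ∑ n ∈ c.support, c n • mFourier n
    have hg : (c.sum fun n z => z • ContinuousMap.toLp (E := ℂ) 2 ν ℂ (mFourier n)) =
        ContinuousMap.toLp (E := ℂ) 2 ν ℂ g := by
      simp only [g, map_sum, map_smul, Finsupp.sum]
    rw [hg]
    have hgc := ContinuousMap.coeFn_toLp (p := 2) (𝕜 := ℂ) ν g
    rw [hP, norm_sq_Lp_two]
    have e1 : ∫ x, ‖ContinuousMap.toLp (E := ℂ) 2 ν ℂ g x‖ ^ 2 ∂ν = ∫ x, ‖g x‖ ^ 2 ∂ν := by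
      refine integral_congr_ae ?_
      filter_upwards [hgc] with x hx
      rw [hx]
    have e2 : ∫ x in E, ‖ContinuousMap.toLp (E := ℂ) 2 ν ℂ g x‖ ^ 2 ∂ν =
        ∫ x in E, ‖g x‖ ^ 2 ∂ν := by
      refine integral_congr_ae ?_
      filter_upwards [ae_restrict_of_ae hgc] with x hx
      rw [hx]
    rw [e1, e2, setIntegral_withDensity_eq_setIntegral_smul hm.nnnorm _ hE,
      integral_withDensity_eq_integral_smul hm.nnnorm, ← integral_indicator hE, ← sub_nonneg,
      ← integral_const_mul]
    have hint : Integrable (fun x => ‖G x‖₊ • ‖g x‖ ^ 2) volume := by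
      refine (hG.norm.bdd_mul (c := ‖g‖ ^ 2) (f := fun x => ‖g x‖ ^ 2)
        (by fun_prop) (Filter.Eventually.of_forall fun x => ?_)).congr ?_
      · rw [norm_pow, norm_norm]
        gcongr
        exact g.norm_coe_le_norm x
      · filter_upwards with x
        rw [NNReal.smul_def, smul_eq_mul, mul_comm, coe_nnnorm]
    rw [← integral_sub hint ((hint.indicator hE).const_mul 2)]
    refine (h c.support c).trans_eq (integral_congr_ae (Filter.Eventually.of_forall fun x => ?_))
    have hgx : g x = ∑ n ∈ c.support, c n * mFourier n x := by simp [g]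
    simp only [← hgx, NNReal.smul_def, coe_nnnorm, smul_eq_mul, Real.norm_eq_abs]
    by_cases hx : x ∈ E
    · rw [Set.indicator_of_mem hx, abs_of_neg hx]
      ring
    · rw [Set.indicator_of_notMem hx, abs_of_nonneg (not_lt.1 hx)]
      ring
  have hall (f : Lp ℂ 2 ν) : 2 * ‖P f‖ ^ 2 ≤ ‖f‖ ^ 2 := by
    have hmem : f ∈ (Submodule.span ℂ (Set.range fun n : d → ℤ =>
      ContinuousMap.toLp (E := ℂ) 2 ν ℂ (mFourier n))).topologicalClosure := by
      rw [span_mFourier_toLp_dense]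
      trivial
    exact closure_minimal (fun f hf => hspan f hf) hcl hmem
  -- The choice `f = 1_E` gives `2 ν(E) ≤ ν(E)`, hence `ν(E) = 0`.
  have h1 := hall (indicatorConstLp 2 hE (measure_ne_top ν E) 1)
  have hind := indicatorConstLp_coeFn (p := 2) (hs := hE) (hμs := measure_ne_top ν E) (c := (1 : ℂ))
  have h2 : ‖P (indicatorConstLp 2 hE (measure_ne_top ν E) 1)‖ ^ 2 = ν.real E := by
    rw [hP]
    refine (setIntegral_congr_ae (g := fun _ => (1 : ℝ)) hE ?_).trans (by simp)
    filter_upwards [hind] with x hx hxE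
    simp [hx, hxE]
  have h3 : ‖indicatorConstLp 2 hE (measure_ne_top ν E) (1 : ℂ)‖ ^ 2 = ν.real E := by
    rw [norm_sq_Lp_two]
    have : ∫ x, E.indicator (fun _ => (1 : ℝ)) x ∂ν = ν.real E := by
      rw [integral_indicator hE]; simp
    rw [← this]
    refine integral_congr_ae ?_
    filter_upwards [hind] with x hx
    by_cases hxE : x ∈ E <;> simp [hx, hxE]
  rw [h2, h3] at h1
  have h4 : ν E = 0 := by
    have : ν.real E = 0 := le_antisymm (by linarith) measureReal_nonneg
    exact (measureReal_eq_zero_iff).1 this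
  rw [withDensity_apply _ hE, lintegral_eq_zero_iff (by fun_prop)] at h4
  rw [Filter.EventuallyEq, ae_restrict_iff' hE] at h4
  filter_upwards [h4] with x hx
  by_contra hlt
  have := hx (not_le.1 hlt)
  simp only [Pi.zero_apply, ENNReal.coe_eq_zero, nnnorm_eq_zero] at this
  exact hlt this.ge

variable {m : Type*} [Fintype m] [DecidableEq m]

theorem trigVec_product (F : Finset (d → ℤ)) (ξ : m → ℂ) (c : (d → ℤ) → ℂ)
    (x : UnitAddTorus d) :
    trigVec (Finset.univ ×ˢ F) (fun j => ξ j.1 * c j.2) x =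
      (∑ n ∈ F, c n * mFourier n x) • ξ := by
  ext r
  simp only [trigVec, Finset.sum_product, Pi.smul_apply, smul_eq_mul, Finset.sum_mul]
  rw [Finset.sum_eq_single r]
  · exact Finset.sum_congr rfl fun n _ => by rw [if_pos rfl]; ring
  · intro s _ hs
    simp [hs]
  · simp

/-- For fixed `ξ`, coefficients of product form `ξ r * c n` test the bounds on a scalar polynomial
times `ξ`. The polynomial factors out as the weight `|P(x)|²`, and `ae_nonneg_of_integral_trigPoly`
removes it. -/
theorem ae_isBoundedMatrix_of_hasRieszBounds
    {Φ : m → m → Lp ℂ 2 (volume : Measure (UnitAddTorus d))} {A B : ℝ}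
    (h : HasRieszBounds (modulatedRows Φ) A B) :
    ∀ᵐ x, IsBoundedMatrix A B (Matrix.of fun r s => Φ r s x) := by
  let M (x : UnitAddTorus d) : Matrix m m ℂ := Matrix.of fun r s => Φ r s x
  have hint (ξ : m → ℂ) : Integrable (fun x => ∑ s, ‖(ξ ᵥ* M x) s‖ ^ 2) volume := by
    -- The single frequency `0` with coefficient `1` makes the scalar polynomial constantly `1`.
    have := (norm_sq_sum_modulatedRows Φ (Finset.univ ×ˢ {0}) fun j => ξ j.1 * (1 : ℂ)).1
    simp only [trigVec_product _ _ fun _ => (1 : ℂ)] at this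
    simpa [mFourier_zero] using this
  have hmain (ξ : m → ℂ) (F : Finset (d → ℤ)) (c : (d → ℤ) → ℂ) :
      A * ∫ x, ‖∑ n ∈ F, c n * mFourier n x‖ ^ 2 * ∑ r, ‖ξ r‖ ^ 2 ≤
        ∫ x, ‖∑ n ∈ F, c n * mFourier n x‖ ^ 2 * ∑ s, ‖(ξ ᵥ* M x) s‖ ^ 2 ∧
      ∫ x, ‖∑ n ∈ F, c n * mFourier n x‖ ^ 2 * ∑ s, ‖(ξ ᵥ* M x) s‖ ^ 2 ≤
        B * ∫ x, ‖∑ n ∈ F, c n * mFourier n x‖ ^ 2 * ∑ r, ‖ξ r‖ ^ 2 := by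
    have := h (Finset.univ ×ˢ F) fun j => ξ j.1 * c j.2
    rw [(norm_sq_sum_modulatedRows Φ _ _).2, (sum_norm_sq_eq_integral_trigVec _ _).2] at this
    simpa only [trigVec_product, Matrix.smul_vecMul, Pi.smul_apply, norm_smul, mul_pow,
      ← Finset.mul_sum] using this
  have hmul {g : UnitAddTorus d → ℝ} (hg : Integrable g volume) (F : Finset (d → ℤ))
      (c : (d → ℤ) → ℂ) :
      Integrable (fun x => ‖∑ n ∈ F, c n * mFourier n x‖ ^ 2 * g x) volume := by
    refine hg.bdd_mul (c := (∑ n ∈ F, ‖c n‖) ^ 2)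
      (Continuous.aestronglyMeasurable (by fun_prop)) (Filter.Eventually.of_forall fun x => ?_)
    rw [norm_pow, norm_norm]
    gcongr
    refine (norm_sum_le _ _).trans (Finset.sum_le_sum fun n _ => ?_)
    rw [norm_mul, norm_mFourier_apply, mul_one]
  have hξ (ξ : m → ℂ) : ∀ᵐ x, A * ∑ r, ‖ξ r‖ ^ 2 ≤ ∑ s, ‖(ξ ᵥ* M x) s‖ ^ 2 ∧
      ∑ s, ‖(ξ ᵥ* M x) s‖ ^ 2 ≤ B * ∑ r, ‖ξ r‖ ^ 2 := by
    have h1 : ∀ᵐ x, 0 ≤ ∑ s, ‖(ξ ᵥ* M x) s‖ ^ 2 - A * ∑ r, ‖ξ r‖ ^ 2 := by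
      refine ae_nonneg_of_integral_trigPoly ((hint ξ).sub (integrable_const _)) fun F c => ?_
      simp only [mul_sub]
      rw [integral_sub (hmul (hint ξ) F c) (hmul (integrable_const _) F c), sub_nonneg]
      refine le_trans (le_of_eq ?_) (hmain ξ F c).1
      rw [← integral_const_mul]
      exact integral_congr_ae (Filter.Eventually.of_forall fun x => by ring)
    have h2 : ∀ᵐ x, 0 ≤ B * ∑ r, ‖ξ r‖ ^ 2 - ∑ s, ‖(ξ ᵥ* M x) s‖ ^ 2 := by
      refine ae_nonneg_of_integral_trigPoly ((integrable_const _).sub (hint ξ)) fun F c => ?_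
      simp only [mul_sub]
      rw [integral_sub (hmul (integrable_const _) F c) (hmul (hint ξ) F c), sub_nonneg]
      refine (hmain ξ F c).2.trans (le_of_eq ?_)
      rw [← integral_const_mul]
      exact integral_congr_ae (Filter.Eventually.of_forall fun x => by ring)
    filter_upwards [h1, h2] with x h1 h2
    exact ⟨sub_nonneg.1 h1, sub_nonneg.1 h2⟩
  -- The exceptional null set depends on `ξ`. A countable dense set of `ξ` gives a common one, and
  -- continuity in `ξ` does the rest.
  have hall := ae_all_iff.2 fun k : ℕ => hξ (TopologicalSpace.denseSeq (m → ℂ) k)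
  filter_upwards [hall] with x hx ξ
  refine (TopologicalSpace.denseRange_denseSeq (m → ℂ)).induction_on (p := fun ξ : m → ℂ =>
    A * ∑ r, ‖ξ r‖ ^ 2 ≤ ∑ s, ‖(ξ ᵥ* M x) s‖ ^ 2 ∧
      ∑ s, ‖(ξ ᵥ* M x) s‖ ^ 2 ≤ B * ∑ r, ‖ξ r‖ ^ 2) ξ ?_ hx
  simp only [Matrix.vecMul, dotProduct]
  refine IsClosed.and ?_ ?_
  · exact isClosed_le (by fun_prop) (by fun_prop)
  · exact isClosed_le (by fun_prop) (by fun_prop)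

theorem IsBoundedMatrix.isUnit {A B : ℝ} {M : Matrix m m ℂ} (hM : IsBoundedMatrix A B M)
    (hA : 0 < A) : IsUnit M := by
  rw [← Matrix.vecMul_injective_iff_isUnit]
  refine (injective_iff_map_eq_zero (Matrix.vecMulLinear M)).2 ?_
  intro ξ hξ
  have h1 := (hM ξ).1
  rw [Matrix.vecMulLinear_apply] at hξ
  simp only [hξ, Pi.zero_apply, norm_zero, ne_eq, OfNat.ofNat_ne_zero, not_false_eq_true, zero_pow,
    Finset.sum_const_zero] at h1
  have h2 : ∑ r, ‖ξ r‖ ^ 2 = 0 :=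
    le_antisymm (by nlinarith) (Finset.sum_nonneg fun _ _ => by positivity)
  rw [Finset.sum_eq_zero_iff_of_nonneg fun _ _ => by positivity] at h2
  ext r
  simpa using h2 r (Finset.mem_univ r)

theorem IsBoundedMatrix.norm_entry_le {A B : ℝ} {M : Matrix m m ℂ} (hM : IsBoundedMatrix A B M)
    (r s : m) : ‖M r s‖ ≤ √B := by
  refine Real.le_sqrt_of_sq_le ?_
  have h := (hM (Pi.single r 1)).2
  have h1 : ∑ i, ‖(Pi.single r 1 : m → ℂ) i‖ ^ 2 = 1 := by
    rw [Finset.sum_eq_single r] <;> simp +contextual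
  rw [h1, mul_one, Matrix.single_one_vecMul] at h
  exact (Finset.single_le_sum (f := fun s => ‖M r s‖ ^ 2) (fun _ _ => by positivity)
    (Finset.mem_univ s)).trans h

/-- If `y` is orthogonal to every modulated row, then for each `r` all Fourier coefficients of `∑ s,
y s * star (Φ r s)` vanish. Hence `Φ` kills the conjugate of `y` almost everywhere, and
invertibility of `Φ` gives `y = 0`. -/
theorem span_modulatedRows_dense {Φ : m → m → Lp ℂ 2 (volume : Measure (UnitAddTorus d))}
    {A B : ℝ} (hA : 0 < A) (h : ∀ᵐ x, IsBoundedMatrix A B (Matrix.of fun r s => Φ r s x)) :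
    (Submodule.span ℂ (Set.range (modulatedRows Φ))).topologicalClosure = ⊤ := by
  rw [Submodule.topologicalClosure_eq_top_iff, Submodule.eq_bot_iff]
  intro y hy
  rw [Submodule.mem_orthogonal] at hy
  -- The upper bound makes the entries of `Φ` bounded, which keeps the product in `L²`.
  have hmem (r s : m) : MemLp (fun x => y s x * star (Φ r s x)) 2 volume := by
    refine (Lp.memLp (y s)).of_le_mul (c := √B)
      ((Lp.aestronglyMeasurable _).mul (Lp.aestronglyMeasurable _).star) ?_
    filter_upwards [h] with x hx
    rw [norm_mul, norm_star, mul_comm]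
    exact mul_le_mul_of_nonneg_right (hx.norm_entry_le r s) (norm_nonneg _)
  have hsum (r : m) : MemLp (fun x => ∑ s, y s x * star (Φ r s x)) 2 volume :=
    memLp_finsetSum _ fun s _ => hmem r s
  have hzero (r : m) : ∀ᵐ x, ∑ s, y s x * star (Φ r s x) = 0 := by
    have h0 : (hsum r).toLp = 0 := by
      refine mFourierCoeff_injective fun n => ?_
      have h1 : mFourierCoeff (0 : Lp ℂ 2 (volume : Measure (UnitAddTorus d))) n = 0 := by
        rw [← mFourierBasis_repr, map_zero]
        rfl
      rw [h1, ← hy (modulatedRows Φ (r, n)) (Submodule.subset_span ⟨_, rfl⟩), PiLp.inner_apply]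
      simp only [L2.inner_def]
      rw [← integral_finsetSum _ fun s _ => L2.integrable_inner _ _]
      refine integral_congr_ae ?_
      have h2 : ∀ᵐ x, ∀ s, (modulatedRows Φ (r, n)) s x = mFourier n x * Φ r s x :=
        Filter.eventually_all.2 fun s => coeFn_mFourierMul n (Φ r s)
      filter_upwards [(hsum r).coeFn_toLp, h2] with x hx hx2
      rw [hx, smul_eq_mul, Finset.mul_sum]
      refine Finset.sum_congr rfl fun s _ => ?_
      rw [hx2, RCLike.inner_apply, map_mul, ← mFourier_neg]
      simp only [starRingEnd_apply]
      ring
    filter_upwards [(hsum r).coeFn_toLp, Lp.coeFn_zero ℂ 2 (volume : Measure (UnitAddTorus d))]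
      with x hx hx'
    rw [← hx, h0, hx', Pi.zero_apply]
  have hy0 : ∀ᵐ x, ∀ s, y s x = 0 := by
    filter_upwards [h, Filter.eventually_all.2 hzero] with x hx hx0
    have hinj := Matrix.mulVec_injective_iff_isUnit.2 (hx.isUnit hA)
    have h3 : (Matrix.of fun r s => Φ r s x) *ᵥ (fun s => star (y s x)) =
        (Matrix.of fun r s => Φ r s x) *ᵥ 0 := by
      rw [Matrix.mulVec_zero]
      ext r
      have := congrArg star (hx0 r)
      simp only [star_sum, star_mul', star_star, star_zero] at this
      rw [Pi.zero_apply, ← this]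
      exact Finset.sum_congr rfl fun s _ => mul_comm _ _
    intro s
    exact star_eq_zero.1 (congrFun (hinj h3) s)
  ext1 s
  rw [PiLp.zero_apply]
  refine Lp.ext ?_
  filter_upwards [hy0, Lp.coeFn_zero ℂ 2 (volume : Measure (UnitAddTorus d))] with x hx hx'
  rw [hx, hx', Pi.zero_apply]

end TorusBounds

/-! ### Matrix inequalities -/

theorem posSemidef_bounds_iff {m : Type*} [Fintype m] [DecidableEq m] (A B : ℝ)
    (M : Matrix m m ℂ) :
    ((M * Mᴴ - (A : ℂ) • (1 : Matrix m m ℂ)).PosSemidef ∧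
      ((B : ℂ) • (1 : Matrix m m ℂ) - M * Mᴴ).PosSemidef) ↔ IsBoundedMatrix A B M := by
  have hc (C : ℝ) : ((C : ℂ) • (1 : Matrix m m ℂ)).IsHermitian := by
    rw [Matrix.IsHermitian, Matrix.conjTranspose_smul, Matrix.conjTranspose_one]
    simp
  have hM := Matrix.isHermitian_mul_conjTranspose_self M
  have h1 (x : m → ℂ) : star x ⬝ᵥ ((M * Mᴴ) *ᵥ x) =
      ((∑ s, ‖(star x ᵥ* M) s‖ ^ 2 : ℝ) : ℂ) := by
    rw [← Matrix.mulVec_mulVec, Matrix.dotProduct_mulVec]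
    have : Mᴴ *ᵥ x = star (star x ᵥ* M) := by rw [Matrix.star_vecMul, star_star]
    rw [this, dotProduct]
    push_cast
    exact Finset.sum_congr rfl fun s _ => Complex.mul_conj' _
  have h2 (C : ℝ) (x : m → ℂ) : star x ⬝ᵥ (((C : ℂ) • (1 : Matrix m m ℂ)) *ᵥ x) =
      ((C * ∑ s, ‖star x s‖ ^ 2 : ℝ) : ℂ) := by
    rw [Matrix.smul_mulVec, Matrix.one_mulVec, dotProduct_smul, dotProduct]
    push_cast
    rw [smul_eq_mul]
    congr 1
    refine Finset.sum_congr rfl fun s _ => ?_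
    rw [Pi.star_apply, norm_star]
    exact Complex.conj_mul' _
  rw [Matrix.posSemidef_iff_dotProduct_mulVec, Matrix.posSemidef_iff_dotProduct_mulVec]
  simp only [hM.sub (hc A), (hc B).sub hM, true_and, Matrix.sub_mulVec, dotProduct_sub, h1, h2,
    ← Complex.ofReal_sub, Complex.zero_le_real, sub_nonneg]
  rw [← forall_and]
  -- The quadratic form at the column `x` is the row inequality at `ξ = star x`; conjugation is a
  -- bijection.
  exact (Equiv.forall_congr_left (Equiv.mk (star : (m → ℂ) → m → ℂ) star star_star star_star)).trans
    (by simp [IsBoundedMatrix])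

/-- Closedness supplies the measurability needed to transfer an almost everywhere statement through
a pushforward of measures. -/
theorem isClosed_isBoundedMatrix {m : Type*} [Fintype m] (A B : ℝ) :
    IsClosed {M : m → m → ℂ | IsBoundedMatrix A B (Matrix.of M)} := by
  simp only [IsBoundedMatrix, Set.ofPred_forall]
  refine isClosed_iInter fun ξ => ?_
  simp only [Matrix.vecMul, dotProduct, Matrix.of_apply]
  refine IsClosed.and ?_ ?_
  · exact isClosed_le (by fun_prop) (by fun_prop)
  · exact isClosed_le (by fun_prop) (by fun_prop)

/-! ### Pullback of square integrable functions -/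

section Pullback

variable {α β : Type*} [MeasurableSpace α] [MeasurableSpace β] {μ : Measure α} {ν : Measure β}
  {Q : α → β} {c : ℝ≥0∞}

theorem memLp_comp_of_map_eq_smul (hQ : Measurable Q) (hc : c ≠ ∞) (h : μ.map Q = c • ν)
    (f : Lp ℂ 2 ν) : MemLp (fun x => f (Q x)) 2 μ := by
  have := (Lp.memLp f).smul_measure hc
  rw [← h] at this
  exact this.comp_of_map hQ.aemeasurable

theorem ae_comp_of_map_eq_smul (hQ : Measurable Q) (h : μ.map Q = c • ν) {P : β → Prop}
    (hP : ∀ᵐ y ∂ν, P y) : ∀ᵐ x ∂μ, P (Q x) := by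
  refine ae_of_ae_map hQ.aemeasurable ?_
  rw [h]
  exact Measure.ae_smul_measure hP c

/-- Composition with a map that preserves measures up to a constant, as an operator on `L²`. -/
noncomputable def pullbackLp (hQ : Measurable Q) (hc : c ≠ ∞) (h : μ.map Q = c • ν) :
    Lp ℂ 2 ν →L[ℂ] Lp ℂ 2 μ :=
  LinearMap.mkContinuous
    { toFun f := (memLp_comp_of_map_eq_smul hQ hc h f).toLp
      map_add' f g := by
        rw [← MemLp.toLp_add, MemLp.toLp_eq_toLp_iff]
        exact ae_comp_of_map_eq_smul hQ h (Lp.coeFn_add f g)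
      map_smul' z f := by
        rw [RingHom.id_apply, ← MemLp.toLp_const_smul, MemLp.toLp_eq_toLp_iff]
        exact ae_comp_of_map_eq_smul hQ h (Lp.coeFn_smul z f) }
    (c ^ (1 / (2 : ℝ≥0∞)).toReal).toReal fun f => by
      have h1 : eLpNorm (fun x => f (Q x)) 2 μ = c ^ (1 / (2 : ℝ≥0∞)).toReal • eLpNorm f 2 ν := by
        rw [← eLpNorm_smul_measure_of_ne_top (by norm_num), ← h, eLpNorm_map_measure _
          hQ.aemeasurable, Function.comp_def]
        rw [h]
        exact (Lp.aestronglyMeasurable f).smul_measure c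
      rw [LinearMap.coe_mk, AddHom.coe_mk, Lp.norm_toLp, h1, smul_eq_mul, ENNReal.toReal_mul,
        Lp.norm_def]

theorem coeFn_pullbackLp (hQ : Measurable Q) (hc : c ≠ ∞) (h : μ.map Q = c • ν) (f : Lp ℂ 2 ν) :
    pullbackLp hQ hc h f =ᵐ[μ] fun x => f (Q x) :=
  MemLp.coeFn_toLp (memLp_comp_of_map_eq_smul hQ hc h f)

end Pullback

/-! ### The period cell and the torus -/

/-- The quotient map from the plane to the torus, for the lattice `(1/a) ℤ × (1/b) ℤ`. -/
noncomputable def toTorus (a b : ℝ) (z : ℝ × ℝ) : UnitAddTorus (Fin 2) :=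
  ![((a * z.1 : ℝ) : UnitAddCircle), ((b * z.2 : ℝ) : UnitAddCircle)]

/-- The representative of a point in the period cell. -/
noncomputable def toCell (a b : ℝ) (z : ℝ × ℝ) : ℝ × ℝ :=
  (Int.fract (a * z.1) / a, Int.fract (b * z.2) / b)

theorem map_mul_restrict_Ico {a : ℝ} (ha : 0 < a) :
    (volume.restrict (Set.Ico 0 (1 / a))).map (fun t : ℝ => ((a * t : ℝ) : UnitAddCircle)) =
      ENNReal.ofReal a⁻¹ • (volume : Measure UnitAddCircle) := by
  have h1 : (fun t : ℝ => a * t) ⁻¹' Set.Ico 0 1 = Set.Ico 0 (1 / a) := by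
    ext t
    simp [ha]
  have h2 : (volume.restrict (Set.Ico 0 (1 / a))).map (fun t : ℝ => a * t) =
      ENNReal.ofReal a⁻¹ • volume.restrict (Set.Ioc 0 (0 + 1)) := by
    rw [← h1, ← Measure.restrict_map (measurable_const_mul a) measurableSet_Ico,
      Real.map_volume_mul_left ha.ne', Measure.restrict_smul, abs_of_pos (inv_pos.2 ha), zero_add,
      Measure.restrict_congr_set Ico_ae_eq_Ioc]
  have h3 : (volume.restrict (Set.Ioc (0 : ℝ) (0 + 1))).map ((↑) : ℝ → UnitAddCircle) =
      (volume : Measure UnitAddCircle) := by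
    refine (AddCircle.measurePreserving_mk 1 0).map_eq.trans ?_
    rw [AddCircle.volume_eq_smul_haarAddCircle, ENNReal.ofReal_one, one_smul]
    rfl
  have h4 : Measurable ((↑) : ℝ → UnitAddCircle) := AddCircle.measurable_mk'
  rw [show (fun t : ℝ => ((a * t : ℝ) : UnitAddCircle)) =
    ((↑) : ℝ → UnitAddCircle) ∘ fun t => a * t from rfl,
    ← Measure.map_map h4 (measurable_const_mul a), h2, Measure.map_smul, h3]

theorem measurable_toTorus (a b : ℝ) : Measurable (toTorus a b) := by
  have h4 : Measurable ((↑) : ℝ → UnitAddCircle) := AddCircle.measurable_mk'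
  refine measurable_pi_iff.2 fun i => ?_
  fin_cases i
  · exact h4.comp (measurable_fst.const_mul a)
  · exact h4.comp (measurable_snd.const_mul b)

theorem map_toTorus {a b : ℝ} (ha : 0 < a) (hb : 0 < b) :
    (volume.restrict (periodCell a b)).map (toTorus a b) =
      (ENNReal.ofReal a⁻¹ * ENNReal.ofReal b⁻¹) •
        (volume : Measure (UnitAddTorus (Fin 2))) := by
  have h4 : Measurable ((↑) : ℝ → UnitAddCircle) := AddCircle.measurable_mk'
  have h5 (c : ℝ) : Measurable fun t : ℝ => ((c * t : ℝ) : UnitAddCircle) :=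
    h4.comp (measurable_const_mul c)
  have h1 : toTorus a b = MeasurableEquiv.finTwoArrow.symm ∘
      Prod.map (fun t : ℝ => ((a * t : ℝ) : UnitAddCircle))
        (fun t : ℝ => ((b * t : ℝ) : UnitAddCircle)) := rfl
  rw [h1, ← Measure.map_map MeasurableEquiv.finTwoArrow.symm.measurable ((h5 a).prodMap (h5 b)),
    periodCell, Measure.volume_eq_prod, ← Measure.prod_restrict,
    ← Measure.map_prod_map _ _ (h5 a) (h5 b), map_mul_restrict_Ico ha, map_mul_restrict_Ico hb,
    Measure.prod_smul_left, Measure.prod_smul_right, smul_smul, Measure.map_smul]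
  congr 1
  exact (volume_preserving_finTwoArrow UnitAddCircle).symm.map_eq

theorem toCell_of_mem {a b : ℝ} (ha : 0 < a) (hb : 0 < b) {z : ℝ × ℝ}
    (hz : z ∈ periodCell a b) : toCell a b z = z := by
  obtain ⟨⟨h1, h2⟩, h3, h4⟩ := hz
  rw [lt_div_iff₀ ‹_›, mul_comm] at h2 h4
  refine Prod.ext ?_ ?_
  · change Int.fract (a * z.1) / a = z.1
    rw [Int.fract_eq_self.2 ⟨by positivity, h2⟩, mul_div_cancel_left₀ _ ha.ne']
  · change Int.fract (b * z.2) / b = z.2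
    rw [Int.fract_eq_self.2 ⟨by positivity, h4⟩, mul_div_cancel_left₀ _ hb.ne']

/-- On each cell of the lattice, `toCell` is a translation, which preserves null sets, and there are
only countably many cells. -/
theorem ae_toCell {a b : ℝ} (ha : 0 < a) (hb : 0 < b) {P : ℝ × ℝ → Prop}
    (h : ∀ᵐ z ∂volume.restrict (periodCell a b), P z) : ∀ᵐ z : ℝ × ℝ, P (toCell a b z) := by
  have hcell : MeasurableSet (periodCell a b) := measurableSet_Ico.prod measurableSet_Ico
  rw [ae_restrict_iff' hcell] at h
  have h1 (v : ℤ × ℤ) : ∀ᵐ z : ℝ × ℝ, z + (-v.1 / a, -v.2 / b) ∈ periodCell a b →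
      P (z + (-v.1 / a, -v.2 / b)) :=
    (measurePreserving_add_right (volume : Measure (ℝ × ℝ))
      (-v.1 / a, -v.2 / b)).quasiMeasurePreserving.ae h
  filter_upwards [ae_all_iff.2 h1] with z hz
  have h2 : toCell a b z = z + (-(⌊a * z.1⌋ : ℝ) / a, -(⌊b * z.2⌋ : ℝ) / b) := by
    refine Prod.ext ?_ ?_
    · simp only [toCell, Int.fract, Prod.fst_add]
      field_simp
      ring
    · simp only [toCell, Int.fract, Prod.snd_add]
      field_simp
      ring
  have h3 : toCell a b z ∈ periodCell a b := by
    refine ⟨⟨?_, ?_⟩, ?_, ?_⟩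
    · exact div_nonneg (Int.fract_nonneg _) ha.le
    · exact (div_lt_div_iff_of_pos_right ha).2 (Int.fract_lt_one _)
    · exact div_nonneg (Int.fract_nonneg _) hb.le
    · exact (div_lt_div_iff_of_pos_right hb).2 (Int.fract_lt_one _)
  have := hz (⌊a * z.1⌋, ⌊b * z.2⌋)
  simp only [← h2] at this
  exact this h3

theorem mFourier_toTorus (a b : ℝ) (k l : ℤ) (z : ℝ × ℝ) :
    mFourier ![-k, -l] (toTorus a b z) =
      Complex.exp (-2 * Real.pi * Complex.I * (b * l * z.2 + a * k * z.1)) := by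
  simp only [mFourier, toTorus, ContinuousMap.coe_mk, Fin.prod_univ_two, Matrix.cons_val_zero,
    Matrix.cons_val_one, fourier_coe_apply]
  rw [← Complex.exp_add]
  congr 1
  push_cast
  ring

/-! ### The symbol on the torus -/

/-- The Fourier coefficients of the entry `(r, s)` of the symbol of `h`. -/
noncomputable def symbolCoeff (a b : ℝ) {p : ℕ} (h : ℤ × ℤ → ℂ) (r s : Fin p) (n : Fin 2 → ℤ) :
    ℂ :=
  h (((s : ℕ) : ℤ) - ((r : ℕ) : ℤ) - p * n 0, -n 1) *
    Complex.exp (2 * Real.pi * Complex.I * (a * b * (r : ℕ) * n 1))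

theorem norm_symbolCoeff (a b : ℝ) {p : ℕ} (h : ℤ × ℤ → ℂ) (r s : Fin p) (n : Fin 2 → ℤ) :
    ‖symbolCoeff a b h r s n‖ = ‖h (((s : ℕ) : ℤ) - ((r : ℕ) : ℤ) - p * n 0, -n 1)‖ := by
  have : (2 * Real.pi * Complex.I * (a * b * (r : ℕ) * n 1) : ℂ) =
      ((2 * Real.pi * (a * b * (r : ℕ) * n 1) : ℝ) : ℂ) * Complex.I := by
    push_cast; ring
  rw [symbolCoeff, norm_mul, this, Complex.norm_exp_ofReal_mul_I, mul_one]

theorem memℓp_symbolCoeff (a b : ℝ) {p : ℕ} {h : ℤ × ℤ → ℂ}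
    (hh : Summable fun kl => ‖h kl‖ ^ 2) (r s : Fin p) : Memℓp (symbolCoeff a b h r s) 2 := by
  refine memℓp_gen ?_
  have hp : (p : ℤ) ≠ 0 := by have := r.pos; omega
  have hinj : Function.Injective fun n : Fin 2 → ℤ =>
      (((s : ℕ) : ℤ) - ((r : ℕ) : ℤ) - p * n 0, -n 1) := by
    intro n n' hn
    simp only [Prod.mk.injEq, neg_inj, sub_right_inj, mul_eq_mul_left_iff, hp, or_false] at hn
    ext i
    fin_cases i
    · exact hn.1
    · exact hn.2
  simpa [norm_symbolCoeff, Function.comp_def] using hh.comp_injective hinj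

/-- The symbol of the square summable sequence `h`, a matrix of functions on the torus. -/
noncomputable def torusSymbol (a b : ℝ) {p : ℕ} {h : ℤ × ℤ → ℂ}
    (hh : Summable fun kl => ‖h kl‖ ^ 2) (r s : Fin p) :
    Lp ℂ 2 (volume : Measure (UnitAddTorus (Fin 2))) :=
  mFourierBasis.repr.symm ⟨symbolCoeff a b h r s, memℓp_symbolCoeff a b hh r s⟩

theorem mFourierCoeff_torusSymbol (a b : ℝ) {p : ℕ} {h : ℤ × ℤ → ℂ}
    (hh : Summable fun kl => ‖h kl‖ ^ 2) (r s : Fin p) (n : Fin 2 → ℤ) :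
    mFourierCoeff (torusSymbol a b hh r s) n = symbolCoeff a b h r s n := by
  rw [← mFourierBasis_repr, torusSymbol, LinearIsometryEquiv.apply_symm_apply]

/-- Pairs of integers as frequencies on the torus, with a change of sign. -/
def negFrequency : ℤ × ℤ ≃ (Fin 2 → ℤ) where
  toFun kl := ![-kl.1, -kl.2]
  invFun n := (-n 0, -n 1)
  left_inv kl := by simp
  right_inv n := by
    ext i
    fin_cases i <;> simp

section Symbol

variable {a b : ℝ} {p : ℕ} {h : ℤ × ℤ → ℂ}

theorem phiTerm_eq_toTorus (a b : ℝ) (h : ℤ × ℤ → ℂ) (r s : Fin p) (kl : ℤ × ℤ) (z : ℝ × ℝ) :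
    phiTerm a b p h r s kl z =
      symbolCoeff a b h r s (negFrequency kl) * mFourier (negFrequency kl) (toTorus a b z) := by
  rw [negFrequency, Equiv.coe_fn_mk, mFourier_toTorus, phiTerm, symbolCoeff]
  congr 2
  · simp
  · simp

/-- Pullback from the torus to the cell is bounded on `L²`, so it maps the Fourier series of the
symbol term by term to the series defining `phiEntry`. -/
theorem coeFn_phiEntry (ha : 0 < a) (hb : 0 < b) (hh : Summable fun kl => ‖h kl‖ ^ 2)
    (r s : Fin p) :
    phiEntry a b p h r s =ᵐ[volume.restrict (periodCell a b)]
      fun z => torusSymbol a b hh r s (toTorus a b z) := by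
  have hc : ENNReal.ofReal a⁻¹ * ENNReal.ofReal b⁻¹ ≠ ∞ :=
    ENNReal.mul_ne_top ENNReal.ofReal_ne_top ENNReal.ofReal_ne_top
  let J := pullbackLp (measurable_toTorus a b) hc (map_toTorus ha hb)
  have h1 : HasSum (fun n => symbolCoeff a b h r s n • mFourierLp 2 n) (torusSymbol a b hh r s) := by
    rw [← coe_mFourierBasis]
    exact mFourierBasis.hasSum_repr_symm ⟨symbolCoeff a b h r s, memℓp_symbolCoeff a b hh r s⟩
  have h2 := (negFrequency.hasSum_iff.2 h1).mapL J
  have h3 : phiEntry a b p h r s = J (torusSymbol a b hh r s) := by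
    rw [phiEntry, ← h2.tsum_eq]
    refine tsum_congr fun kl => ?_
    refine Lp.ext ?_
    rw [Function.comp_apply, map_smul]
    filter_upwards [(memLp_phiTerm a b p h r s kl).coeFn_toLp,
      Lp.coeFn_smul (symbolCoeff a b h r s (negFrequency kl)) (J (mFourierLp 2 (negFrequency kl))),
      coeFn_pullbackLp (measurable_toTorus a b) hc (map_toTorus ha hb)
        (mFourierLp 2 (negFrequency kl)),
      ae_comp_of_map_eq_smul (measurable_toTorus a b) (map_toTorus ha hb)
        (coeFn_mFourierLp 2 (negFrequency kl))] with z e1 e2 e3 e4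
    rw [e1, e2, Pi.smul_apply, e3, e4, smul_eq_mul, phiTerm_eq_toTorus]
  rw [h3]
  exact coeFn_pullbackLp _ _ _ _

/-- The period cell maps to the torus with Lebesgue measure going to a positive multiple of Haar
measure, so null sets correspond; periodicity extends the statement from the cell to the plane. -/
theorem ae_isBoundedMatrix_phiRep_iff (ha : 0 < a) (hb : 0 < b)
    (hh : Summable fun kl => ‖h kl‖ ^ 2) (A B : ℝ) :
    (∀ᵐ z : ℝ × ℝ, IsBoundedMatrix A B (phiRep a b p h z)) ↔
      ∀ᵐ x, IsBoundedMatrix A B (Matrix.of fun r s : Fin p => torusSymbol a b hh r s x) := by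
  have hentry : ∀ᵐ z ∂volume.restrict (periodCell a b), ∀ r s : Fin p,
      phiEntry a b p h r s z = torusSymbol a b hh r s (toTorus a b z) :=
    Filter.eventually_all.2 fun r => Filter.eventually_all.2 fun s => coeFn_phiEntry ha hb hh r s
  have hrep (z : ℝ × ℝ) : phiRep a b p h z =
      Matrix.of fun r s => phiEntry a b p h r s (toCell a b z) := rfl
  constructor
  · intro H
    have hcell : MeasurableSet (periodCell a b) := measurableSet_Ico.prod measurableSet_Ico
    have h1 : ∀ᵐ z ∂volume.restrict (periodCell a b), IsBoundedMatrix A B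
        (Matrix.of fun r s : Fin p => torusSymbol a b hh r s (toTorus a b z)) := by
      filter_upwards [hentry, ae_restrict_of_ae H, ae_restrict_mem hcell] with z hz h2 h3
      rw [hrep, toCell_of_mem ha hb h3] at h2
      simpa only [hz] using h2
    have hmeas : Measurable fun (x : UnitAddTorus (Fin 2)) (r s : Fin p) =>
        torusSymbol a b hh r s x :=
      measurable_pi_iff.2 fun r => measurable_pi_iff.2 fun s =>
        (Lp.stronglyMeasurable _).measurable
    have h2 := (ae_map_iff (measurable_toTorus a b).aemeasurable
      (hmeas (isClosed_isBoundedMatrix A B).measurableSet)).2 h1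
    rw [map_toTorus ha hb] at h2
    rwa [Filter.Eventually, Measure.ae_ennreal_smul_measure_eq (by simp [ha, hb])] at h2
  · intro H
    have h1 : ∀ᵐ z ∂volume.restrict (periodCell a b), IsBoundedMatrix A B
        (Matrix.of fun r s : Fin p => phiEntry a b p h r s z) := by
      filter_upwards [hentry, ae_comp_of_map_eq_smul (measurable_toTorus a b)
        (map_toTorus ha hb) H] with z hz h2
      simpa only [hz] using h2
    exact ae_toCell ha hb h1

end Symbol

/-! ### Time-frequency shifts -/

theorem coeFn_translation (y : ℝ) (f : L2R) : translation y f =ᵐ[volume] fun t => f (t - y) :=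
  Lp.coeFn_compMeasurePreserving f (measurePreserving_sub_right volume y)

theorem coeFn_modulation (ξ : ℝ) (f : L2R) :
    modulation ξ f =ᵐ[volume] fun t => Complex.exp (2 * Real.pi * Complex.I * ξ * t) * f t :=
  MemLp.coeFn_toLp _

theorem coeFn_gaborSystem (s : L2R) (a b : ℝ) (kl : ℤ × ℤ) :
    gaborSystem s a b kl =ᵐ[volume] fun t =>
      Complex.exp (2 * Real.pi * Complex.I * (b * kl.2 : ℝ) * t) * s (t - a * kl.1) := by
  filter_upwards [coeFn_modulation (b * kl.2) (translation (a * kl.1) s),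
    coeFn_translation (a * kl.1) s] with t h1 h2
  rw [gaborSystem, h1, h2]

/-- The composition of two time-frequency shifts. -/
theorem gaborSystem_gaborSystem (v : L2R) (a b : ℝ) (κ kl : ℤ × ℤ) :
    gaborSystem (gaborSystem v a b kl) a b κ =
      Complex.exp (-2 * Real.pi * Complex.I * (a * b * κ.1 * kl.2)) •
        gaborSystem v a b (κ + kl) := by
  refine Lp.ext ?_
  have h0 := (measurePreserving_sub_right (volume : Measure ℝ)
    (a * κ.1)).quasiMeasurePreserving.ae (coeFn_gaborSystem v a b kl)
  filter_upwards [coeFn_gaborSystem (gaborSystem v a b kl) a b κ, h0,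
    coeFn_gaborSystem v a b (κ + kl), Lp.coeFn_smul
      (Complex.exp (-2 * Real.pi * Complex.I * (a * b * κ.1 * kl.2)))
      (gaborSystem v a b (κ + kl))] with t h1 h2 h3 h4
  rw [h1, h2, h4, Pi.smul_apply, h3, smul_eq_mul, ← mul_assoc, ← mul_assoc, ← Complex.exp_add,
    ← Complex.exp_add]
  congr 2
  · simp only [Prod.snd_add]
    push_cast
    ring
  · simp only [Prod.fst_add]
    push_cast
    ring

/-- Modulation as an isometry. -/
noncomputable def modulationIsometry (ξ : ℝ) : L2R →ₗᵢ[ℂ] L2R where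
  toFun := modulation ξ
  map_add' f g := by
    refine Lp.ext ?_
    filter_upwards [coeFn_modulation ξ (f + g), coeFn_modulation ξ f, coeFn_modulation ξ g,
      Lp.coeFn_add f g, Lp.coeFn_add (modulation ξ f) (modulation ξ g)] with t h1 h2 h3 h4 h5
    rw [h1, h4, h5, Pi.add_apply, Pi.add_apply, h2, h3, mul_add]
  map_smul' c f := by
    refine Lp.ext ?_
    filter_upwards [coeFn_modulation ξ (c • f), coeFn_modulation ξ f,
      Lp.coeFn_smul c f, Lp.coeFn_smul c (modulation ξ f)] with t h1 h2 h3 h4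
    rw [RingHom.id_apply, h1, h3, h4, Pi.smul_apply, Pi.smul_apply, h2, smul_eq_mul, smul_eq_mul]
    ring
  norm_map' f := by
    refine (Lp.norm_le_norm_of_ae_le ?_).antisymm (Lp.norm_le_norm_of_ae_le ?_) <;>
    · filter_upwards [coeFn_modulation ξ f] with t ht
      have : (2 * Real.pi * Complex.I * ξ * t : ℂ) =
          ((2 * Real.pi * ξ * t : ℝ) : ℂ) * Complex.I := by
        push_cast; ring
      simp [ht, this, Complex.norm_exp_ofReal_mul_I, -Complex.ofReal_mul]

/-- A time-frequency shift as an operator. -/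
noncomputable def gaborShift (a b : ℝ) (κ : ℤ × ℤ) : L2R →L[ℂ] L2R :=
  (modulationIsometry (b * κ.2)).toContinuousLinearMap ∘L
    (Lp.compMeasurePreservingₗᵢ ℂ (fun t : ℝ => t - a * κ.1)
      (measurePreserving_sub_right volume (a * κ.1))).toContinuousLinearMap

theorem gaborShift_apply (a b : ℝ) (κ : ℤ × ℤ) (f : L2R) :
    gaborShift a b κ f = gaborSystem f a b κ := rfl

/-! ### Polyphase indexing -/

/-- The index `(r - p n₀, -n₁)` of the time-frequency shift with residue `r` and frequency `n`. -/
def polyphaseIndex (p : ℕ) (j : Fin p × (Fin 2 → ℤ)) : ℤ × ℤ :=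
  (((j.1 : ℕ) : ℤ) - p * j.2 0, -j.2 1)

/-- This is division with remainder by `p` in the translation index. -/
theorem polyphaseIndex_bijective {p : ℕ} (hp : 0 < p) :
    Function.Bijective (polyphaseIndex p) := by
  have hp' : (0 : ℤ) < p := by exact_mod_cast hp
  constructor
  · rintro ⟨r, n⟩ ⟨s, k⟩ h
    simp only [polyphaseIndex, Prod.mk.injEq, neg_inj] at h
    have hmod (t : Fin p) (i : ℤ) : (((t : ℕ) : ℤ) - p * i) % p = (t : ℕ) := by
      rw [Int.sub_mul_emod_self_left]
      exact Int.emod_eq_of_lt (by positivity) (by exact_mod_cast t.isLt)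
    have hrs : r = s := by
      have := congrArg (· % (p : ℤ)) h.1
      simp only [hmod] at this
      exact Fin.ext (by exact_mod_cast this)
    subst hrs
    have h0 : n 0 = k 0 := by
      have : (p : ℤ) * n 0 = p * k 0 := by linarith [h.1]
      exact mul_left_cancel₀ hp'.ne' this
    refine Prod.ext rfl (funext fun i => ?_)
    fin_cases i
    · exact h0
    · exact h.2
  · rintro ⟨k, l⟩
    have h1 := Int.emod_nonneg k hp'.ne'
    have h2 := Int.emod_lt_of_pos k hp'
    refine ⟨(⟨(k % p).toNat, by omega⟩, ![-(k / p), -l]), ?_⟩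
    simp only [polyphaseIndex, Int.toNat_of_nonneg h1, Matrix.cons_val_zero, Matrix.cons_val_one,
      neg_neg, Prod.mk.injEq, and_true]
    have := Int.emod_add_mul_ediv k p
    linarith

/-- Applying the shift of index `j` to the series of `w` yields another series along the shifts of
`v`. After reindexing, its coefficients are the Fourier coefficients of the modulated row, since
multiplication by a monomial translates Fourier coefficients; the phases agree because `a b p` is an
integer. -/
theorem synthesis_modulatedRows {a b : ℝ} {p q : ℕ} (hp : 0 < p) (hab : a * b = (q : ℝ) / (p : ℝ))
    {v w : L2R} {h : ℤ × ℤ → ℂ} (hw : HasSum (fun kl : ℤ × ℤ => h kl • gaborSystem v a b kl) w)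
    (hh : Summable fun kl => ‖h kl‖ ^ 2) {R : TorusVec (Fin 2) (Fin p) →L[ℂ] L2R}
    (hR : ∀ x, HasSum (fun j => (torusVecBasis (Fin 2) (Fin p)).repr x j •
      gaborSystem v a b (polyphaseIndex p j)) (R x)) (j : Fin p × (Fin 2 → ℤ)) :
    R (modulatedRows (torusSymbol a b hh) j) = gaborSystem w a b (polyphaseIndex p j) := by
  refine (hR _).unique ?_
  let e : Fin p × (Fin 2 → ℤ) ≃ ℤ × ℤ :=
    (Equiv.ofBijective _ (polyphaseIndex_bijective hp)).trans (Equiv.subRight (polyphaseIndex p j))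
  have h1 := e.hasSum_iff.2 (hw.mapL (gaborShift a b (polyphaseIndex p j)))
  rw [gaborShift_apply] at h1
  refine h1.congr_fun fun i => ?_
  have he : e i = polyphaseIndex p i - polyphaseIndex p j := rfl
  have hpq : (a * b * p : ℂ) = q := by
    have : a * b * p = q := by
      rw [hab, div_mul_cancel₀]
      exact_mod_cast hp.ne'
    exact_mod_cast this
  rw [Function.comp_apply, he, map_smul, gaborShift_apply, gaborSystem_gaborSystem,
    add_sub_cancel, smul_smul, torusVecBasis_repr, modulatedRows, PiLp.toLp_apply,
    mFourierCoeff_mFourierMul, mFourierCoeff_torusSymbol, symbolCoeff]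
  congr 2
  · congr 1
    simp only [polyphaseIndex, Prod.mk_sub_mk, Pi.sub_apply, Prod.mk.injEq]
    constructor <;> ring
  · rw [Complex.exp_eq_exp_iff_exists_int]
    -- The translation part of the shift is `r - p n₀` with `n = j.2`. The term `p n₀` contributes
    -- the phase `-2π a b p n₀ (i.2 1 - j.2 1)`, a multiple of `2π` since `a b p = q`.
    refine ⟨q * j.2 0 * (i.2 1 - j.2 1), ?_⟩
    simp only [polyphaseIndex, Prod.snd_sub, Pi.sub_apply]
    push_cast
    rw [← hpq]
    ring

/-! ### The characterization of Riesz bases for the same space -/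

theorem proposition3p3 (a b : ℝ) (ha : 0 < a) (hb : 0 < b)
    (p q : ℕ) (hp : 0 < p) (hq : 0 < q) (hpq : Nat.Coprime p q) (hab : a * b = (q : ℝ) / (p : ℝ))
    (v : L2R) (V : Submodule ℂ L2R) (hv : IsRieszBasisFor (gaborSystem v a b) V)
    (h : ℤ × ℤ → ℂ) (w : L2R) (hw : HasSum (fun kl : ℤ × ℤ => h kl • gaborSystem v a b kl) w) :
    IsRieszBasisFor (gaborSystem w a b) V ↔
      ∃ A B : ℝ, 0 < A ∧ ∀ᵐ z : ℝ × ℝ,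
        (phiRep a b p h z * (phiRep a b p h z)ᴴ - (A : ℂ) • (1 : Matrix (Fin p) (Fin p) ℂ)).PosSemidef ∧
        ((B : ℂ) • (1 : Matrix (Fin p) (Fin p) ℂ) - phiRep a b p h z * (phiRep a b p h z)ᴴ).PosSemidef := by
  obtain ⟨A₀, B₀, hA₀, hv₀⟩ := hv.hasRieszBounds
  have hh : Summable fun kl => ‖h kl‖ ^ 2 := hv₀.summable_of_hasSum hA₀ hw
  let e : Fin p × (Fin 2 → ℤ) ≃ ℤ × ℤ := Equiv.ofBijective _ (polyphaseIndex_bijective hp)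
  obtain ⟨R, hR, ⟨A₁, B₁, hA₁, hbd⟩, hV⟩ := ((isRieszBasisFor_comp_equiv e).2 hv).exists_synthesis
    (torusVecBasis (Fin 2) (Fin p))
  have hsyn : R ∘ modulatedRows (torusSymbol a b hh) = gaborSystem w a b ∘ e :=
    funext (synthesis_modulatedRows hp hab hw hh hR)
  simp only [posSemidef_bounds_iff, ae_isBoundedMatrix_phiRep_iff ha hb hh]
  rw [← isRieszBasisFor_comp_equiv e, ← hsyn]
  constructor
  · intro H
    obtain ⟨A, B, hA, hAB⟩ := H.hasRieszBounds
    -- Only the norm inequalities of the Riesz basis enter here; they are pulled back through `R`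
    -- and then localized.
    exact ⟨_, _, by positivity, ae_isBoundedMatrix_of_hasRieszBounds (hAB.of_map hA₁ hbd)⟩
  · rintro ⟨A, B, hA, hAB⟩
    exact isRieszBasisFor_map hA₁ hA hbd hV (span_modulatedRows_dense hA hAB)
      (hasRieszBounds_modulatedRows hAB)
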